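/- Let $A\in\mathbb R^{n\times n}$, $B\in\mathbb R^{n\times p}$, $C\in\mathbb R^{m\times n}$, $D\in\mathbb R^{m\times p}$ with $n\ge 1$ be an observable and controllable linear system, let $T_1,T_2\ge 1$, $T=T_1+T_2+1$, and let $G=[D,\,CB,\,CAB,\dots,CA^{T-2}B]\in\mathbb R^{m\times Tp}$ be its Markov parameter matrix. Let $\hat G\in\mathbb R^{m\times Tp}$ be an arbitrary matrix. For $X=[X_1,\dots,X_T]\in\mathbb R^{m\times Tp}$ with blocks $X_k\in\mathbb R^{m\times p}$, the Ho-Kalman algorithm of order $n$ proceeds as follows. Form the Hankel matrix $H\in\mathbb R^{mT_1\times p(T_2+1)}$ whose $(i,j)$ block is $X_{i+j}$ ($1\le i\le T_1$, $1\le j\le T_2+1$). Let $H^-$ and $H^+$ be $H$ without its last, respectively its first, block column. Let $L$ be a best rank-$n$ approximation of $H^-$, obtained from a singular value decomposition of $H^-$ by setting all but the top $n$ singular values to zero, and let $L=U\Sigma V^*$ be a singular value decomposition with $\Sigma\in\mathbb R^{n\times n}$. Put $O=U\Sigma^{1/2}$ and $Q=\Sigma^{1/2}V^*$. The outputs are: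 $C$-matrix $=$ first $m$ rows of $O$; $B$-matrix $=$ first $p$ columns of $Q$; $A$-matrix $=O^\dagger H^+Q^\dagger$, where $\dagger$ is the Moore-Penrose inverse. Let $H,L,O,Q,\bar A,\bar B,\bar C$ be the matrices obtained in this way from $G$, and $\hat H,\hat L,\hat O,\hat Q,\hat A,\hat B,\hat C$ those obtained from $\hat G$, for any choice of the rank-$n$ approximations and of the singular value decompositions. Write $\|\cdot\|$ for the spectral norm, $\|\cdot\|_F$ for the Frobenius norm, and $\sigma_{\min}(L)$ for the $n$-th largest singular value of $L$. Suppose that $\sigma_{\min}(L)>0$ and $$\|H-\hat H\|\le \sigma_{\min}(L)/4 .$$ Then there is an orthogonal matrix $W\in\mathbb R^{n\times n}$ such that $$\max\bigl\{\|\bar C-\hat C W\|_F,\ \|O-\hat O W\|_F,\ \|\bar B-W^*\hat B\|_F,\ \|Q-W^*\hat Q\|_F\bigr\}\le 5\sqrt{n\|H-\hat H\|}$$ and $$\|\bar A-W^*\hat A W\|_F\le \frac{50\,\sqrt{n\|H-\hat H\|}\;\|H\|}{\sigma_{\min}(L)^{3/2}} .$$ -/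

import Mathlib

open scoped Matrix

noncomputable section

namespace HoKalman

/-! ### Norms, singular values, pseudo-inverse -/

open scoped Matrix.Norms.L2Operator in
/-- Spectral norm (largest singular value) of a real matrix. -/
def specNorm {ι κ : Type*} [Fintype ι] [Fintype κ] [DecidableEq κ] (M : Matrix ι κ ℝ) : ℝ := ‖M‖

/-- Frobenius norm of a real matrix. -/
def frobNorm {ι κ : Type*} [Fintype ι] [Fintype κ] (M : Matrix ι κ ℝ) : ℝ :=
  Real.sqrt (∑ i, ∑ j, M i j ^ 2)

/-- The `k`-th largest singular value of a real matrix, counted from `k = 1`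
(Mathlib's sequence of singular values is counted from `0`). -/
def singularValue {ι κ : Type*} [Fintype ι] [Fintype κ] [DecidableEq κ]
    (k : ℕ) (M : Matrix ι κ ℝ) : ℝ :=
  (Matrix.toEuclideanLin M).singularValues (k - 1)

/-- `X` is a Moore–Penrose inverse of `M`: the four Penrose equations. -/
structure IsMoorePenrose {ι κ : Type*} [Fintype ι] [Fintype κ]
    (M : Matrix ι κ ℝ) (X : Matrix κ ι ℝ) : Prop where
  mul_mul : M * X * M = M
  mul_mul' : X * M * X = X
  symm_left : (M * X)ᵀ = M * X
  symm_right : (X * M)ᵀ = X * M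

theorem exists_isMoorePenrose {ι κ : Type*} [Fintype ι] [Fintype κ]
    (M : Matrix ι κ ℝ) : ∃ X : Matrix κ ι ℝ, IsMoorePenrose M X := by
  classical
  have hH : (Mᵀ * M).IsHermitian := by
    simp [Matrix.IsHermitian, Matrix.conjTranspose_eq_transpose_of_trivial, Matrix.transpose_mul]
  obtain ⟨W, d, hW, hW', hD⟩ : ∃ (W : Matrix κ κ ℝ) (d : κ → ℝ),
      Wᵀ * W = 1 ∧ W * Wᵀ = 1 ∧ Mᵀ * M = W * Matrix.diagonal d * Wᵀ := by
    refine ⟨hH.eigenvectorUnitary, hH.eigenvalues, ?_, ?_, ?_⟩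
    · have := (Matrix.mem_unitaryGroup_iff').1 hH.eigenvectorUnitary.2
      simpa [Matrix.star_eq_conjTranspose, Matrix.conjTranspose_eq_transpose_of_trivial] using this
    · have := (Matrix.mem_unitaryGroup_iff).1 hH.eigenvectorUnitary.2
      simpa [Matrix.star_eq_conjTranspose, Matrix.conjTranspose_eq_transpose_of_trivial] using this
    · have := hH.spectral_theorem
      simpa [Unitary.conjStarAlgAut_apply, Matrix.star_eq_conjTranspose,
        Matrix.conjTranspose_eq_transpose_of_trivial, Function.comp_def] using this
  set E : Matrix κ κ ℝ := Matrix.diagonal (fun k => (d k)⁻¹) with hE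
  set D : Matrix κ κ ℝ := Matrix.diagonal d with hDdef
  have hET : Eᵀ = E := by simp [hE]
  have hDED : D * E * D = D := by
    simp only [hE, hDdef, Matrix.diagonal_mul_diagonal]
    congr 1; funext k
    exact mul_inv_mul_cancel (d k)
  have hEDE : E * D * E = E := by
    simp only [hE, hDdef, Matrix.diagonal_mul_diagonal]
    congr 1; funext k
    by_cases h : d k = 0 <;> simp [h]
  have hEDT : (E * D)ᵀ = E * D := by
    simp [hE, hDdef, Matrix.diagonal_mul_diagonal]
  have hXM : W * E * Wᵀ * Mᵀ * M = W * (E * D) * Wᵀ := by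
    calc W * E * Wᵀ * Mᵀ * M = W * E * Wᵀ * (Mᵀ * M) := by simp only [Matrix.mul_assoc]
      _ = W * E * (Wᵀ * W) * D * Wᵀ := by rw [hD]; simp only [Matrix.mul_assoc]
      _ = _ := by rw [hW]; simp only [Matrix.mul_assoc, Matrix.one_mul]
  refine ⟨W * E * Wᵀ * Mᵀ, ?_, ?_, ?_, ?_⟩
  · have key : Mᵀ * M * (1 - W * (E * D) * Wᵀ) = 0 := by
      have : Mᵀ * M * (W * (E * D) * Wᵀ) = Mᵀ * M := by
        calc Mᵀ * M * (W * (E * D) * Wᵀ) = W * D * (Wᵀ * W) * (E * D) * Wᵀ := by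
              rw [hD]; simp only [Matrix.mul_assoc]
          _ = W * (D * E * D) * Wᵀ := by rw [hW]; simp only [Matrix.mul_assoc, Matrix.one_mul]
          _ = Mᵀ * M := by rw [hDED, hD]
      rw [Matrix.mul_sub, Matrix.mul_one, this, sub_self]
    have key2 : M * (1 - W * (E * D) * Wᵀ) = 0 := by
      apply (Matrix.conjTranspose_mul_self_eq_zero).1
      rw [Matrix.conjTranspose_eq_transpose_of_trivial, Matrix.transpose_mul, Matrix.mul_assoc,
        ← Matrix.mul_assoc Mᵀ, key, Matrix.mul_zero]
    rw [Matrix.mul_sub, Matrix.mul_one, sub_eq_zero] at key2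
    rw [Matrix.mul_assoc M, hXM, ← key2]
  · rw [hXM]
    calc W * (E * D) * Wᵀ * (W * E * Wᵀ * Mᵀ)
        = W * E * D * (Wᵀ * W) * E * Wᵀ * Mᵀ := by simp only [Matrix.mul_assoc]
      _ = W * (E * D * E) * Wᵀ * Mᵀ := by rw [hW]; simp only [Matrix.mul_assoc, Matrix.one_mul]
      _ = _ := by rw [hEDE]
  · simp only [Matrix.transpose_mul, Matrix.transpose_transpose, hET, Matrix.mul_assoc]
  · rw [hXM, Matrix.transpose_mul, Matrix.transpose_mul, hEDT, Matrix.transpose_transpose]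
    simp only [Matrix.mul_assoc]

theorem IsMoorePenrose.unique {ι κ : Type*} [Fintype ι] [Fintype κ]
    {M : Matrix ι κ ℝ} {X Y : Matrix κ ι ℝ} (hX : IsMoorePenrose M X) (hY : IsMoorePenrose M Y) :
    X = Y := by
  have h1 : M * X = M * Y := by
    calc M * X = (M * X)ᵀ := hX.symm_left.symm
      _ = (M * Y * M * X)ᵀ := by rw [hY.mul_mul]
      _ = (M * X)ᵀ * (M * Y)ᵀ := by rw [← Matrix.transpose_mul, Matrix.mul_assoc (M * Y)]
      _ = M * X * M * Y := by rw [hX.symm_left, hY.symm_left, ← Matrix.mul_assoc]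
      _ = M * Y := by rw [hX.mul_mul]
  have h2 : X * M = Y * M := by
    calc X * M = (X * M)ᵀ := hX.symm_right.symm
      _ = (X * (M * Y * M))ᵀ := by rw [hY.mul_mul]
      _ = (Y * M)ᵀ * (X * M)ᵀ := by rw [← Matrix.transpose_mul]; simp only [Matrix.mul_assoc]
      _ = Y * (M * X * M) := by
        rw [hX.symm_right, hY.symm_right]; simp only [Matrix.mul_assoc]
      _ = Y * M := by rw [hX.mul_mul]
  calc X = X * M * X := hX.mul_mul'.symm
    _ = Y * (M * X) := by rw [h2, Matrix.mul_assoc]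
    _ = Y * M * Y := by rw [h1, Matrix.mul_assoc]
    _ = Y := hY.mul_mul'

/-- The Moore–Penrose inverse of a real matrix. -/
def pinv {ι κ : Type*} [Fintype ι] [Fintype κ] (M : Matrix ι κ ℝ) : Matrix κ ι ℝ :=
  (exists_isMoorePenrose M).choose

theorem pinv_spec {ι κ : Type*} [Fintype ι] [Fintype κ] (M : Matrix ι κ ℝ) :
    IsMoorePenrose M (pinv M) :=
  (exists_isMoorePenrose M).choose_spec

/-- `X = U diag(s) Vᵀ` is a singular value decomposition of `X` with `r` singular triples:
orthonormal columns in `U` and in `V`, nonnegative singular values in nonincreasing order. -/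
structure IsSVD {ι κ : Type*} [Fintype ι] [Fintype κ] {r : ℕ} (X : Matrix ι κ ℝ)
    (U : Matrix ι (Fin r) ℝ) (s : Fin r → ℝ) (V : Matrix κ (Fin r) ℝ) : Prop where
  orthonormal_left : Uᵀ * U = 1
  orthonormal_right : Vᵀ * V = 1
  nonneg : ∀ k, 0 ≤ s k
  antitone : Antitone s
  eq : X = U * Matrix.diagonal s * Vᵀ

/-- `L` is a best rank-`n` approximation of `X`: in some singular value decomposition of `X`,
all but the top `n` singular values are set to zero. -/
def IsRankApprox {ι κ : Type*} [Fintype ι] [Fintype κ] (n : ℕ) (X L : Matrix ι κ ℝ) : Prop :=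
  ∃ (r : ℕ) (U : Matrix ι (Fin r) ℝ) (s : Fin r → ℝ) (V : Matrix κ (Fin r) ℝ),
    IsSVD X U s V ∧
      L = U * Matrix.diagonal (fun k : Fin r => if (k : ℕ) < n then s k else 0) * Vᵀ

/-! ### Linear systems -/

/-- The system is observable: the stacked matrix `[C; CA; …; CAⁿ⁻¹]` has rank `n`. -/
def IsObservable {n m : ℕ} (A : Matrix (Fin n) (Fin n) ℝ) (C : Matrix (Fin m) (Fin n) ℝ) : Prop :=
  (Matrix.of fun (i : Fin n × Fin m) (k : Fin n) => (C * A ^ (i.1 : ℕ)) i.2 k).rank = n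

/-- The system is controllable: the matrix `[B, AB, …, Aⁿ⁻¹B]` has rank `n`. -/
def IsControllable {n p : ℕ} (A : Matrix (Fin n) (Fin n) ℝ) (B : Matrix (Fin n) (Fin p) ℝ) :
    Prop :=
  (Matrix.of fun (k : Fin n) (j : Fin n × Fin p) => (A ^ (j.1 : ℕ) * B) k j.2).rank = n

/-- The Markov parameter matrix `G = [D, CB, CAB, …, CA^{T-2}B]`, an `m × Tp` matrix whose columns
are indexed by the block and the position in the block. -/
def markov {n m p : ℕ} (T : ℕ) (A : Matrix (Fin n) (Fin n) ℝ) (B : Matrix (Fin n) (Fin p) ℝ)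
    (C : Matrix (Fin m) (Fin n) ℝ) (D : Matrix (Fin m) (Fin p) ℝ) :
    Matrix (Fin m) (Fin T × Fin p) ℝ :=
  Matrix.of fun i j =>
    match (j.1 : ℕ) with
    | 0 => D i j.2
    | k + 1 => (C * A ^ k * B) i j.2

/-- The `(T₁, S)` Hankel matrix of `X = [X₁, …, X_T]`, where `T₁ + S ≤ T`. Counted from `1`, its
`(i, j)` block is `X_{i+j}`; counted from `0` as here, it is block number `i + j + 1` of `X`. -/
def hankel {m p T : ℕ} (T₁ S : ℕ) (h : T₁ + S ≤ T) (X : Matrix (Fin m) (Fin T × Fin p) ℝ) :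
    Matrix (Fin T₁ × Fin m) (Fin S × Fin p) ℝ :=
  Matrix.of fun i j =>
    X i.2 (⟨(i.1 : ℕ) + (j.1 : ℕ) + 1, by have := i.1.isLt; have := j.1.isLt; omega⟩, j.2)

/-- Discard the rightmost block of columns. -/
def dropLast {ι : Type*} {p S : ℕ} (H : Matrix ι (Fin (S + 1) × Fin p) ℝ) :
    Matrix ι (Fin S × Fin p) ℝ :=
  H.submatrix id fun j => (j.1.castSucc, j.2)

/-- Discard the leftmost block of columns. -/
def dropFirst {ι : Type*} {p S : ℕ} (H : Matrix ι (Fin (S + 1) × Fin p) ℝ) :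
    Matrix ι (Fin S × Fin p) ℝ :=
  H.submatrix id fun j => (j.1.succ, j.2)

/-! ### The Ho–Kalman algorithm -/

/-- A run of the Ho–Kalman algorithm with system order `n`, on an input `G` with `(T₁, T₂ + 1)`
Hankel matrix `H`. It records the only choices the algorithm makes: a best rank-`n` approximation
`L` of `H⁻` (that is, of `H` without its last block column) and a singular value
decomposition `L = U Σ Vᵀ` with an `n × n` diagonal matrix `Σ = diag(s)`. -/
structure Run {m p T : ℕ} (n T₁ T₂ : ℕ) (hT : T₁ + T₂ + 1 = T)
    (G : Matrix (Fin m) (Fin T × Fin p) ℝ) where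
  L : Matrix (Fin T₁ × Fin m) (Fin T₂ × Fin p) ℝ
  isRankApprox : IsRankApprox n (dropLast (hankel T₁ (T₂ + 1) hT.le G)) L
  U : Matrix (Fin T₁ × Fin m) (Fin n) ℝ
  s : Fin n → ℝ
  V : Matrix (Fin T₂ × Fin p) (Fin n) ℝ
  isSVD : IsSVD L U s V

namespace Run

variable {m p n T T₁ T₂ : ℕ} {hT : T₁ + T₂ + 1 = T} {G : Matrix (Fin m) (Fin T × Fin p) ℝ}

/-- The Hankel matrix `H`. -/
def H (_R : Run n T₁ T₂ hT G) : Matrix (Fin T₁ × Fin m) (Fin (T₂ + 1) × Fin p) ℝ :=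
  hankel T₁ (T₂ + 1) hT.le G

/-- The observability matrix `O = U Σ^{1/2}`. -/
def O (R : Run n T₁ T₂ hT G) : Matrix (Fin T₁ × Fin m) (Fin n) ℝ :=
  R.U * Matrix.diagonal fun k => Real.sqrt (R.s k)

/-- The controllability matrix `Q = Σ^{1/2} Vᵀ`. -/
def Q (R : Run n T₁ T₂ hT G) : Matrix (Fin n) (Fin T₂ × Fin p) ℝ :=
  (Matrix.diagonal fun k => Real.sqrt (R.s k)) * R.Vᵀ

/-- The output `C`: the first `m` rows of `O`. -/
def outC (R : Run n T₁ T₂ hT G) (h₁ : 0 < T₁) : Matrix (Fin m) (Fin n) ℝ :=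
  R.O.submatrix (fun i => (⟨0, h₁⟩, i)) id

/-- The output `B`: the first `p` columns of `Q`. -/
def outB (R : Run n T₁ T₂ hT G) (h₂ : 0 < T₂) : Matrix (Fin n) (Fin p) ℝ :=
  R.Q.submatrix id (fun j => (⟨0, h₂⟩, j))

/-- The output `A = O† H⁺ Q†`, with `H⁺` the matrix `H` without its first block column. -/
def outA (R : Run n T₁ T₂ hT G) : Matrix (Fin n) (Fin n) ℝ :=
  pinv R.O * dropFirst R.H * pinv R.Q

end Run

end HoKalman

end

namespace HoKalman

open Matrix

/-! ### Spectral and Frobenius norms -/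

section Norms

variable {ι κ l : Type*} [Fintype ι] [Fintype κ] [Fintype l]

/-! Write δ = ‖H - Ĥ‖ and σ for the `n`-th singular value of L. The exact H⁻ factors through
dimension n (`dropLast_hankel_markov`), so it equals L and competes in the best approximation of Ĥ⁻.
Hence ‖Ĥ⁻ - L̂‖ ≤ δ and ‖L - L̂‖ ≤ 2δ ≤ σ/2. The singular values of L̂ in the run are therefore at
least σ/2, and since L and L̂ both have rank at most n, ‖L - L̂‖_F ≤ 4√n δ
(`frobNorm_sub_le_of_isSVD`).

The core is `exists_orthogonal_balanced_factors`. Stack Z = [O; Qᵀ] and Ẑ = [Ô; Q̂ᵀ], and let W be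
the orthogonal polar factor of ẐᵀZ, so that (ẐW)ᵀZ is positive semidefinite. For such a pair, ‖Z -
ẐW‖_F is controlled by ‖ZZᵀ - ẐẐᵀ‖_F (`mul_frobNorm_sub_sq_le`). Balance, OᵀO = QQᵀ = Σ, makes the
latter at most 2‖L - L̂‖_F. Thus σ‖Z - ẐW‖_F² ≤ 64nδ² ≤ 16nδσ, and one W serves both factors with
error 4√(nδ).

The bound for A follows by telescoping O†H⁺Q† (`frobNorm_mul_mul_sub_le`). The pseudo-inverses have
norm at most (σ/2)^(-1/2), and `IsLeftPinv.frobNorm_sub_le` controls their differences. -/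

theorem norm_toLp_sq (x : ι → ℝ) : ‖WithLp.toLp 2 x‖ ^ 2 = x ⬝ᵥ x := by
  rw [EuclideanSpace.norm_sq_eq]
  simp [dotProduct, sq]

theorem dotProduct_self_nonneg' (x : ι → ℝ) : 0 ≤ x ⬝ᵥ x :=
  Finset.sum_nonneg fun _ _ => mul_self_nonneg _

section Spec

variable [DecidableEq κ]

theorem specNorm_nonneg (M : Matrix ι κ ℝ) : 0 ≤ specNorm M := by
  unfold specNorm
  open scoped Matrix.Norms.L2Operator in exact norm_nonneg M

theorem dotProduct_mulVec_self_le (M : Matrix ι κ ℝ) (x : κ → ℝ) :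
    (M *ᵥ x) ⬝ᵥ (M *ᵥ x) ≤ specNorm M ^ 2 * (x ⬝ᵥ x) := by
  have h := l2_opNorm_mulVec M (WithLp.toLp 2 x)
  rw [← norm_toLp_sq, ← norm_toLp_sq, ← mul_pow]
  exact pow_le_pow_left₀ (norm_nonneg _) h 2

theorem specNorm_add_le (M N : Matrix ι κ ℝ) : specNorm (M + N) ≤ specNorm M + specNorm N := by
  unfold specNorm
  open scoped Matrix.Norms.L2Operator in exact norm_add_le M N

theorem specNorm_sub_comm (M N : Matrix ι κ ℝ) : specNorm (M - N) = specNorm (N - M) := by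
  unfold specNorm
  open scoped Matrix.Norms.L2Operator in exact norm_sub_rev M N

theorem specNorm_mul_le [DecidableEq l] (M : Matrix ι κ ℝ) (N : Matrix κ l ℝ) :
    specNorm (M * N) ≤ specNorm M * specNorm N :=
  l2_opNorm_mul M N

theorem specNorm_transpose [DecidableEq ι] (M : Matrix ι κ ℝ) : specNorm Mᵀ = specNorm M := by
  rw [← conjTranspose_eq_transpose_of_trivial]
  exact l2_opNorm_conjTranspose M

theorem specNorm_transpose_mul_self (M : Matrix ι κ ℝ) :
    specNorm (Mᵀ * M) = specNorm M ^ 2 := by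
  rw [← conjTranspose_eq_transpose_of_trivial, sq]
  exact l2_opNorm_conjTranspose_mul_self M

theorem specNorm_diagonal_le {d : κ → ℝ} {c : ℝ} (hc : 0 ≤ c) (h : ∀ k, |d k| ≤ c) :
    specNorm (diagonal d) ≤ c := by
  unfold specNorm
  rw [l2_opNorm_diagonal]
  exact (pi_norm_le_iff_of_nonneg hc).2 h

theorem specNorm_le_one_of_orthonormal {U : Matrix ι κ ℝ} (h : Uᵀ * U = 1) : specNorm U ≤ 1 := by
  have h1 : specNorm (1 : Matrix κ κ ℝ) ≤ 1 := by
    rw [← diagonal_one]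
    exact specNorm_diagonal_le zero_le_one fun k => by simp
  rw [← h, specNorm_transpose_mul_self] at h1
  exact (sq_le_one_iff₀ (specNorm_nonneg _)).1 h1

/-- The C*-identity turns the hypothesis into ‖P‖ = ‖P‖². -/
theorem specNorm_le_one_of_projection {P : Matrix κ κ ℝ} (h : Pᵀ * P = P) : specNorm P ≤ 1 := by
  have h1 := specNorm_transpose_mul_self P
  rw [h] at h1
  nlinarith [specNorm_nonneg P]

end Spec

/-- Selecting distinct columns is right multiplication by a matrix with orthonormal columns. This is
how bounds on H pass to H⁻ and H⁺. -/
theorem specNorm_submatrix_le [DecidableEq κ] [DecidableEq l] (M : Matrix ι κ ℝ) {f : l → κ}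
    (hf : Function.Injective f) : specNorm (M.submatrix id f) ≤ specNorm M := by
  set P : Matrix κ l ℝ := (1 : Matrix κ κ ℝ).submatrix id f with hP
  have h1 : M.submatrix id f = M * P := by
    ext i j
    simp [hP, mul_apply, one_apply]
  have h2 : Pᵀ * P = 1 := by
    ext i j
    simp [hP, mul_apply, one_apply, hf.eq_iff, eq_comm]
  rw [h1]
  refine (specNorm_mul_le _ _).trans ?_
  exact mul_le_of_le_one_right (specNorm_nonneg _) (specNorm_le_one_of_orthonormal h2)

theorem frobNorm_nonneg (M : Matrix ι κ ℝ) : 0 ≤ frobNorm M := Real.sqrt_nonneg _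

theorem frobNorm_sq (M : Matrix ι κ ℝ) : frobNorm M ^ 2 = ∑ i, ∑ j, M i j ^ 2 :=
  Real.sq_sqrt (Finset.sum_nonneg fun _ _ => Finset.sum_nonneg fun _ _ => sq_nonneg _)

theorem frobNorm_sq_eq_trace (M : Matrix ι κ ℝ) : frobNorm M ^ 2 = trace (Mᵀ * M) := by
  rw [frobNorm_sq, Finset.sum_comm]
  simp [trace, mul_apply, sq]

theorem frobNorm_transpose (M : Matrix ι κ ℝ) : frobNorm Mᵀ = frobNorm M := by
  unfold frobNorm
  rw [Finset.sum_comm]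
  rfl

theorem frobNorm_eq_norm (M : Matrix ι κ ℝ) :
    frobNorm M = ‖(WithLp.toLp 2 fun q : ι × κ => M q.1 q.2 : EuclideanSpace ℝ (ι × κ))‖ := by
  rw [EuclideanSpace.norm_eq, frobNorm, Fintype.sum_prod_type]
  simp

theorem frobNorm_add_le (M N : Matrix ι κ ℝ) : frobNorm (M + N) ≤ frobNorm M + frobNorm N := by
  rw [frobNorm_eq_norm, frobNorm_eq_norm, frobNorm_eq_norm]
  exact norm_add_le (WithLp.toLp 2 fun q : ι × κ => M q.1 q.2 : EuclideanSpace ℝ (ι × κ))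
    (WithLp.toLp 2 fun q : ι × κ => N q.1 q.2 : EuclideanSpace ℝ (ι × κ))

theorem frobNorm_neg (M : Matrix ι κ ℝ) : frobNorm (-M) = frobNorm M := by
  simp [frobNorm]

theorem frobNorm_sq_eq_sum_col (M : Matrix ι κ ℝ) :
    frobNorm M ^ 2 = ∑ j, (fun i => M i j) ⬝ᵥ (fun i => M i j) := by
  rw [frobNorm_sq, Finset.sum_comm]
  simp [dotProduct, sq]

theorem frobNorm_mul_le_left [DecidableEq κ] (M : Matrix ι κ ℝ) (N : Matrix κ l ℝ) :
    frobNorm (M * N) ≤ specNorm M * frobNorm N := by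
  refine le_of_sq_le_sq ?_ (mul_nonneg (specNorm_nonneg _) (frobNorm_nonneg _))
  rw [mul_pow, frobNorm_sq_eq_sum_col, frobNorm_sq_eq_sum_col, Finset.mul_sum]
  exact Finset.sum_le_sum fun j _ => dotProduct_mulVec_self_le M fun i => N i j

theorem frobNorm_mul_le_right [DecidableEq κ] [DecidableEq l]
    (M : Matrix ι κ ℝ) (N : Matrix κ l ℝ) :
    frobNorm (M * N) ≤ frobNorm M * specNorm N := by
  rw [← frobNorm_transpose, transpose_mul, mul_comm, ← frobNorm_transpose M,
    ← specNorm_transpose N]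
  exact frobNorm_mul_le_left _ _

/-- Each column is the image of a unit vector. Only the number of columns enters, which is where
factors √n come from once a matrix is compressed to n columns. -/
theorem frobNorm_le_sqrt_card_mul [DecidableEq κ] (M : Matrix ι κ ℝ) :
    frobNorm M ≤ √(Fintype.card κ) * specNorm M := by
  refine le_of_sq_le_sq ?_ (mul_nonneg (Real.sqrt_nonneg _) (specNorm_nonneg _))
  rw [mul_pow, Real.sq_sqrt (Nat.cast_nonneg _), frobNorm_sq_eq_sum_col]
  have h : ∀ j ∈ Finset.univ, ((fun i => M i j) ⬝ᵥ (fun i => M i j)) ≤ specNorm M ^ 2 := by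
    intro j _
    have h := dotProduct_mulVec_self_le M (Pi.single j 1)
    simp only [mulVec_single_one, dotProduct_single, Pi.single_eq_same, mul_one] at h
    exact h
  simpa using Finset.sum_le_card_nsmul _ _ _ h

theorem frobNorm_submatrix_le {ι' κ' : Type*} [Fintype ι'] [Fintype κ'] (M : Matrix ι κ ℝ)
    {f : ι' → ι} {g : κ' → κ} (hf : Function.Injective f) (hg : Function.Injective g) :
    frobNorm (M.submatrix f g) ≤ frobNorm M := by
  refine Real.sqrt_le_sqrt ?_
  simp only [submatrix_apply, ← Fintype.sum_prod_type']
  have hfg : Function.Injective (Prod.map f g) := hf.prodMap hg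
  have h := Finset.sum_le_univ_sum_of_nonneg (s := Finset.univ.map ⟨_, hfg⟩)
    (f := fun q : ι × κ => M q.1 q.2 ^ 2) fun _ => sq_nonneg _
  rw [Finset.sum_map] at h
  exact h

end Norms

/-! ### Polar decomposition and orthogonal alignment -/

section Procrustes

variable {ι κ : Type*} [Fintype ι] [Fintype κ]

/-- Polar decomposition of a square real matrix. -/
theorem exists_orthogonal_transpose_mul_eq [DecidableEq κ] (M : Matrix κ κ ℝ) :
    ∃ W : Matrix κ κ ℝ, Wᵀ * W = 1 ∧ W * Wᵀ = 1 ∧ (Wᵀ * M).PosSemidef := by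
  have hS : (Mᵀ * M).PosSemidef := by
    rw [← conjTranspose_eq_transpose_of_trivial]
    exact posSemidef_conjTranspose_mul_self M
  have hH := hS.isHermitian
  set d := hH.eigenvalues with hd
  have hd0 : ∀ i, 0 ≤ d i := hS.eigenvalues_nonneg
  obtain ⟨P, hP, hP', hD⟩ : ∃ P : Matrix κ κ ℝ,
      Pᵀ * P = 1 ∧ P * Pᵀ = 1 ∧ Mᵀ * M = P * diagonal d * Pᵀ := by
    refine ⟨hH.eigenvectorUnitary, ?_, ?_, ?_⟩
    · have := mem_unitaryGroup_iff'.1 hH.eigenvectorUnitary.2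
      simpa [star_eq_conjTranspose, conjTranspose_eq_transpose_of_trivial] using this
    · have := mem_unitaryGroup_iff.1 hH.eigenvectorUnitary.2
      simpa [star_eq_conjTranspose, conjTranspose_eq_transpose_of_trivial] using this
    · have := hH.spectral_theorem
      simpa [Unitary.conjStarAlgAut_apply, star_eq_conjTranspose,
        conjTranspose_eq_transpose_of_trivial, Function.comp_def] using this
  have hMP : (M * P)ᵀ * (M * P) = diagonal d := by
    calc (M * P)ᵀ * (M * P) = Pᵀ * (Mᵀ * M) * P := by
          simp only [transpose_mul, Matrix.mul_assoc]
      _ = (Pᵀ * P) * diagonal d * (Pᵀ * P) := by rw [hD]; simp only [Matrix.mul_assoc]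
      _ = diagonal d := by rw [hP, Matrix.one_mul, Matrix.mul_one]
  have hcol : ∀ i j, ∑ k, (M * P) k i * (M * P) k j = if i = j then d i else 0 := by
    intro i j
    have := congrFun (congrFun hMP i) j
    rw [mul_apply, diagonal_apply] at this
    exact this
  -- The columns of `M * P` are orthogonal with squared lengths `d i`. The nonzero ones are
  -- normalised and extended to an orthonormal basis, so a singular `M` is allowed.
  let v : κ → EuclideanSpace ℝ κ := fun i => WithLp.toLp 2 fun k => (√(d i))⁻¹ * (M * P) k i
  have hv : Orthonormal ℝ ({i | d i ≠ 0}.domRestrict v) := by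
    rw [orthonormal_iff_ite]
    rintro ⟨i, hi⟩ ⟨j, hj⟩
    have h1 : inner ℝ (v i) (v j) = (√(d i))⁻¹ * (√(d j))⁻¹ * if i = j then d i else 0 := by
      rw [← hcol, Finset.mul_sum]
      simp only [v, PiLp.inner_apply, RCLike.inner_apply, conj_trivial]
      exact Finset.sum_congr rfl fun k _ => by ring
    simp only [Set.domRestrict_apply, h1, Subtype.mk.injEq]
    split_ifs with h
    · subst h
      rw [← mul_inv, Real.mul_self_sqrt (hd0 i), inv_mul_cancel₀ hi]
    · simp
  obtain ⟨b, hb⟩ := hv.exists_orthonormalBasis_extension_of_card_eq (by simp)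
  let Q : Matrix κ κ ℝ := of fun k i => b i k
  have hQ : Qᵀ * Q = 1 := by
    ext i j
    have := orthonormal_iff_ite.1 b.orthonormal j i
    simp only [PiLp.inner_apply, RCLike.inner_apply, conj_trivial] at this
    simpa [Q, mul_apply, one_apply, eq_comm] using this
  have hQ' : Q * Qᵀ = 1 := mul_eq_one_comm.1 hQ
  have hMQ : M * P = Q * diagonal fun i => √(d i) := by
    ext k i
    rw [mul_diagonal]
    by_cases hi : d i = 0
    · have h1 := hcol i i
      simp only [if_true, hi] at h1
      have h2 := (Finset.sum_eq_zero_iff_of_nonneg fun k _ => mul_self_nonneg _).1 h1 k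
        (Finset.mem_univ k)
      simp [hi, mul_self_eq_zero.1 h2]
    · have h1 : b i k = (√(d i))⁻¹ * (M * P) k i := by rw [hb i hi]
      have h3 : √(d i) ≠ 0 := by
        rw [Real.sqrt_ne_zero (hd0 i)]; exact hi
      simp only [Q, of_apply, h1]
      field_simp
  refine ⟨Q * Pᵀ, ?_, ?_, ?_⟩
  · rw [transpose_mul, transpose_transpose, Matrix.mul_assoc, ← Matrix.mul_assoc Qᵀ, hQ,
      Matrix.one_mul, hP']
  · rw [transpose_mul, transpose_transpose, Matrix.mul_assoc, ← Matrix.mul_assoc Pᵀ, hP,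
      Matrix.one_mul, hQ']
  · have h1 : (Q * Pᵀ)ᵀ * M = P * diagonal (fun i => √(d i)) * Pᴴ := by
      calc (Q * Pᵀ)ᵀ * M = P * (Qᵀ * (M * P)) * Pᵀ := by
            rw [transpose_mul, transpose_transpose]
            simp only [Matrix.mul_assoc]
            rw [hP', Matrix.mul_one]
        _ = P * ((Qᵀ * Q) * diagonal fun i => √(d i)) * Pᵀ := by rw [hMQ, Matrix.mul_assoc Qᵀ]
        _ = _ := by rw [hQ, Matrix.one_mul, conjTranspose_eq_transpose_of_trivial]
    rw [h1]
    exact (PosSemidef.diagonal fun i => Real.sqrt_nonneg _).mul_mul_conjTranspose_same P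

theorem dotProduct_mulVec_nonneg_of_posSemidef {K : Matrix κ κ ℝ} (h : K.PosSemidef) (x : κ → ℝ) :
    0 ≤ x ⬝ᵥ (K *ᵥ x) := by
  simpa using h.dotProduct_mulVec_nonneg x

/-- If `Xᵀ U` is positive semidefinite, `U - X` is controlled by `U Uᵀ - X Xᵀ`. -/
theorem mul_frobNorm_sub_sq_le [DecidableEq ι] {U X : Matrix ι κ ℝ} {c : ℝ}
    (hU : ∀ x : κ → ℝ, c * (x ⬝ᵥ x) ≤ (U *ᵥ x) ⬝ᵥ (U *ᵥ x)) (h : (Xᵀ * U).PosSemidef) :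
    c / 2 * frobNorm (U - X) ^ 2 ≤ frobNorm (U * Uᵀ - X * Xᵀ) ^ 2 := by
  have hsym : Uᵀ * X = Xᵀ * U := by
    have := h.isHermitian.eq
    rwa [conjTranspose_eq_transpose_of_trivial, transpose_mul, transpose_transpose] at this
  set N := U + X with hN
  set E := U - X with hE
  have hNE : Nᵀ * E = Uᵀ * U - Xᵀ * X := by
    simp only [hN, hE, transpose_add, Matrix.add_mul, Matrix.mul_sub, hsym]
    abel
  have hNEs : (Nᵀ * E)ᵀ = Nᵀ * E := by
    rw [hNE]; simp [transpose_mul]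
  -- Polarisation of a difference of squares in the sum `N` and the difference `E`.
  have hF : U * Uᵀ - X * Xᵀ = (1 / 2 : ℝ) • (E * Nᵀ + N * Eᵀ) := by
    simp only [hN, hE, transpose_add, transpose_sub, Matrix.add_mul, Matrix.mul_add,
      Matrix.sub_mul, Matrix.mul_sub]
    ext i j
    simp only [Matrix.sub_apply, Matrix.add_apply, Matrix.smul_apply, smul_eq_mul]
    ring
  -- The cross term is the trace of (NᵀE)². Symmetry of `Nᵀ * E` turns it into a squared Frobenius
  -- norm, which can then be dropped.
  have htr : frobNorm (U * Uᵀ - X * Xᵀ) ^ 2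
      = (frobNorm (N * Eᵀ) ^ 2 + frobNorm (Nᵀ * E) ^ 2) / 2 := by
    have a1 : trace (N * Eᵀ * (E * Nᵀ)) = trace (E * Nᵀ * (N * Eᵀ)) := trace_mul_comm _ _
    have a2 : trace (E * Nᵀ * (E * Nᵀ)) = trace (Nᵀ * E * (Nᵀ * E)) := by
      rw [Matrix.mul_assoc, trace_mul_comm E, Matrix.mul_assoc, Matrix.mul_assoc, Matrix.mul_assoc]
    have a3 : trace (N * Eᵀ * (N * Eᵀ)) = trace (E * Nᵀ * (E * Nᵀ)) := by
      rw [← trace_transpose]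
      simp only [transpose_mul, transpose_transpose]
    rw [frobNorm_sq_eq_trace, frobNorm_sq_eq_trace, frobNorm_sq_eq_trace, hNEs, hF]
    simp only [transpose_smul, transpose_add, transpose_mul, transpose_transpose,
      Matrix.smul_mul, Matrix.mul_smul, trace_smul, Matrix.add_mul, Matrix.mul_add, trace_add,
      smul_eq_mul]
    rw [a1, a3, a2]
    ring
  have hlow : c * frobNorm E ^ 2 ≤ frobNorm (N * Eᵀ) ^ 2 := by
    rw [← frobNorm_transpose E, frobNorm_sq_eq_sum_col, frobNorm_sq_eq_sum_col, Finset.mul_sum]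
    refine Finset.sum_le_sum fun j _ => ?_
    set x : κ → ℝ := fun i => Eᵀ i j
    -- Positive semidefiniteness makes the mixed term nonnegative, so `N` expands at least as much
    -- as `U`.
    have h1 : (N *ᵥ x) ⬝ᵥ (N *ᵥ x) = (U *ᵥ x) ⬝ᵥ (U *ᵥ x) + (X *ᵥ x) ⬝ᵥ (X *ᵥ x)
        + 2 * (x ⬝ᵥ ((Xᵀ * U) *ᵥ x)) := by
      have h2 : x ⬝ᵥ ((Xᵀ * U) *ᵥ x) = (X *ᵥ x) ⬝ᵥ (U *ᵥ x) := by
        rw [← mulVec_mulVec, dotProduct_mulVec, vecMul_transpose]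
      rw [h2, hN, add_mulVec, dotProduct_add, add_dotProduct, add_dotProduct,
        dotProduct_comm (U *ᵥ x) (X *ᵥ x)]
      ring
    change _ ≤ (N *ᵥ x) ⬝ᵥ (N *ᵥ x)
    have h3 := dotProduct_mulVec_nonneg_of_posSemidef h x
    have h4 := dotProduct_self_nonneg' (X *ᵥ x)
    have h5 := hU x
    linarith
  rw [htr]
  nlinarith [sq_nonneg (frobNorm (Nᵀ * E))]

end Procrustes

/-! ### Singular values and best rank-n approximation -/

section SingularValues

variable {ι κ l : Type*} [Fintype ι] [Fintype κ] [Fintype l]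

theorem mulVec_dotProduct_mulVec (M : Matrix ι κ ℝ) (x : κ → ℝ) :
    (M *ᵥ x) ⬝ᵥ (M *ᵥ x) = x ⬝ᵥ ((Mᵀ * M) *ᵥ x) := by
  rw [← mulVec_mulVec, dotProduct_mulVec x, vecMul_transpose]

theorem mulVec_dotProduct_mulVec_of_orthonormal [DecidableEq κ] {M : Matrix ι κ ℝ}
    (h : Mᵀ * M = 1) (x : κ → ℝ) : (M *ᵥ x) ⬝ᵥ (M *ᵥ x) = x ⬝ᵥ x := by
  rw [mulVec_dotProduct_mulVec, h, one_mulVec]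

theorem mul_dotProduct_le_of_diagonal [DecidableEq κ] {M : Matrix ι κ ℝ} {d : κ → ℝ} {c : ℝ}
    (h : Mᵀ * M = diagonal d) (hd : ∀ k, c ≤ d k) (x : κ → ℝ) :
    c * (x ⬝ᵥ x) ≤ (M *ᵥ x) ⬝ᵥ (M *ᵥ x) := by
  rw [mulVec_dotProduct_mulVec, h, dotProduct, dotProduct, Finset.mul_sum]
  refine Finset.sum_le_sum fun k _ => ?_
  rw [mulVec_diagonal]
  nlinarith [hd k, mul_self_nonneg (x k)]

theorem exists_mulVec_eq_zero_of_card_lt (M : Matrix ι κ ℝ)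
    (h : Fintype.card ι < Fintype.card κ) : ∃ x : κ → ℝ, x ≠ 0 ∧ M *ᵥ x = 0 := by
  have := LinearMap.ker_ne_bot_of_finrank_lt (f := M.mulVecLin) (by simpa using h)
  obtain ⟨x, hx, hx0⟩ := (Submodule.ne_bot_iff _).1 this
  exact ⟨x, hx0, hx⟩

theorem dotProduct_self_pos {x : κ → ℝ} (hx : x ≠ 0) : 0 < x ⬝ᵥ x :=
  lt_of_le_of_ne (dotProduct_self_nonneg' x) fun h => hx (dotProduct_self_eq_zero.1 h.symm)

/-- On the span of the top `n` right singular vectors, `M` expands by the `n`-th singular value. -/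
theorem exists_orthonormal_singularValue_le [DecidableEq κ] {n : ℕ} {M : Matrix ι κ ℝ}
    (hσ : 0 < singularValue n M) :
    ∃ P : Matrix κ (Fin n) ℝ, Pᵀ * P = 1 ∧
      ∀ x, singularValue n M ^ 2 * (x ⬝ᵥ x) ≤ ((M * P) *ᵥ x) ⬝ᵥ ((M * P) *ᵥ x) := by
  set T := toEuclideanLin M with hT
  obtain ⟨N, hN⟩ : ∃ N, Module.finrank ℝ (EuclideanSpace ℝ κ) = N := ⟨_, rfl⟩
  -- Singular values of index at least the dimension vanish, so positivity leaves room for n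
  -- eigenvectors.
  have hnN : n - 1 < N := by
    by_contra hcon
    have := T.singularValues_of_finrank_le (hN.trans_le (not_lt.1 hcon))
    rw [singularValue, this] at hσ
    exact lt_irrefl _ hσ
  have hle : n ≤ N := by omega
  set b := T.isSymmetric_adjoint_comp_self.eigenvectorBasis hN with hb
  set ev := T.isSymmetric_adjoint_comp_self.eigenvalues hN with hev
  let e : Fin n → Fin N := Fin.castLE hle
  have he : Function.Injective e := Fin.castLE_injective hle
  have hbo := fun i j => orthonormal_iff_ite.1 b.orthonormal i j
  let P : Matrix κ (Fin n) ℝ := of fun k i => b (e i) k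
  have hMP : (M * P)ᵀ * (M * P) = diagonal fun i => ev (e i) := by
    ext i j
    have h1 : inner ℝ (T (b (e j))) (T (b (e i))) = ev (e j) * if e j = e i then 1 else 0 := by
      rw [← LinearMap.adjoint_inner_left]
      have h2 : T.adjoint (T (b (e j))) = (ev (e j)) • b (e j) := by
        exact T.isSymmetric_adjoint_comp_self.apply_eigenvectorBasis hN (e j)
      rw [h2, inner_smul_left, hbo]
      simp
    have h3 : ∀ i k, T (b (e i)) k = (M * P) k i := fun i k => rfl
    simp only [PiLp.inner_apply, RCLike.inner_apply, conj_trivial, h3, he.eq_iff] at h1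
    rw [mul_apply, diagonal_apply]
    simp only [transpose_apply]
    rw [h1]
    by_cases hij : i = j
    · simp [hij]
    · simp [hij, Ne.symm hij]
  refine ⟨P, ?_, mul_dotProduct_le_of_diagonal hMP fun i => ?_⟩
  · ext i j
    have := hbo (e j) (e i)
    simp only [PiLp.inner_apply, RCLike.inner_apply, conj_trivial, he.eq_iff] at this
    simpa [P, mul_apply, one_apply, eq_comm] using this
  · rw [hev, ← LinearMap.sq_singularValues_fin]
    exact pow_le_pow_left₀ hσ.le (T.singularValues_antitone
      (show (e i : ℕ) ≤ n - 1 by simp only [e, Fin.val_castLE]; omega)) 2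

theorem IsSVD.mul_right {r : ℕ} {X : Matrix ι κ ℝ} {U : Matrix ι (Fin r) ℝ} {s : Fin r → ℝ}
    {V : Matrix κ (Fin r) ℝ} (h : IsSVD X U s V) : X * V = U * diagonal s := by
  rw [h.eq, Matrix.mul_assoc, h.orthonormal_right, Matrix.mul_one]

/-- A dimension count: the n - 1 conditions that `Vᵀ * P` sends x into the k-th coordinate axis have
a nonzero solution. On that x, `L * P` stretches by at most `s k`. The argument treats every k alike
and does not use the ordering of `s`. -/
theorem IsSVD.le_of_orthonormal {n : ℕ} {L : Matrix ι κ ℝ} {U : Matrix ι (Fin n) ℝ}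
    {s : Fin n → ℝ} {V : Matrix κ (Fin n) ℝ} (h : IsSVD L U s V) {P : Matrix κ (Fin n) ℝ}
    [DecidableEq κ]
    (hP : Pᵀ * P = 1) {c : ℝ} (hc : ∀ x, c ^ 2 * (x ⬝ᵥ x) ≤ ((L * P) *ᵥ x) ⬝ᵥ ((L * P) *ᵥ x))
    (k : Fin n) : c ≤ s k := by
  obtain ⟨x, hx, hx0⟩ := exists_mulVec_eq_zero_of_card_lt
    ((Vᵀ * P).submatrix (fun i : {i : Fin n // i ≠ k} => (i : Fin n)) id)
    (Fintype.card_subtype_lt (x := k) (by simp))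
  set y := (Vᵀ * P) *ᵥ x with hy
  have hy0 : ∀ i, i ≠ k → y i = 0 := fun i hi => congrFun hx0 ⟨i, hi⟩
  have hLP : (L * P) *ᵥ x = U *ᵥ (diagonal s *ᵥ y) := by
    rw [hy, h.eq]
    simp only [mulVec_mulVec, Matrix.mul_assoc]
  have hyy : y ⬝ᵥ y = y k * y k :=
    Finset.sum_eq_single k (fun i _ hi => by simp [hy0 i hi]) (by simp)
  have hsy : (diagonal s *ᵥ y) ⬝ᵥ (diagonal s *ᵥ y) = s k ^ 2 * (y ⬝ᵥ y) := by
    rw [hyy, dotProduct, Finset.sum_eq_single k (fun i _ hi => by simp [mulVec_diagonal, hy0 i hi])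
      (by simp), mulVec_diagonal]
    ring
  have hVP : specNorm (Vᵀ * P) ≤ 1 := by
    refine (specNorm_mul_le _ _).trans (mul_le_one₀ ?_ (specNorm_nonneg _)
      (specNorm_le_one_of_orthonormal hP))
    rw [specNorm_transpose]
    exact specNorm_le_one_of_orthonormal h.orthonormal_right
  have hyx : y ⬝ᵥ y ≤ x ⬝ᵥ x := by
    refine (dotProduct_mulVec_self_le (Vᵀ * P) x).trans ?_
    exact mul_le_of_le_one_left (dotProduct_self_nonneg' x)
      (pow_le_one₀ (specNorm_nonneg _) hVP)
  have h1 := hc x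
  rw [hLP, mulVec_dotProduct_mulVec_of_orthonormal h.orthonormal_left, hsy] at h1
  have h2 : c ^ 2 * (x ⬝ᵥ x) ≤ s k ^ 2 * (x ⬝ᵥ x) :=
    h1.trans (mul_le_mul_of_nonneg_left hyx (sq_nonneg _))
  exact le_of_sq_le_sq (le_of_mul_le_mul_right h2 (dotProduct_self_pos hx)) (h.nonneg k)

/-- Singular values beyond the `n`-th are bounded by the distance to a matrix that factors
through dimension `n`. -/
theorem IsSVD.le_of_factor [DecidableEq κ] {n r : ℕ} {X : Matrix ι κ ℝ} {U : Matrix ι (Fin r) ℝ}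
    {s : Fin r → ℝ} {V : Matrix κ (Fin r) ℝ} (h : IsSVD X U s V) {F : Matrix ι (Fin n) ℝ}
    {K : Matrix (Fin n) κ ℝ} {δ : ℝ} (hδ : specNorm (X - F * K) ≤ δ) {k : Fin r}
    (hk : n ≤ (k : ℕ)) : s k ≤ δ := by
  have hlt : n + 1 ≤ r := by omega
  let e : Fin (n + 1) → Fin r := Fin.castLE hlt
  have he : Function.Injective e := Fin.castLE_injective hlt
  set P : Matrix κ (Fin (n + 1)) ℝ := V.submatrix id e with hPdef
  have hP : Pᵀ * P = 1 := by
    have : Pᵀ * P = (Vᵀ * V).submatrix e e := rfl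
    rw [this, h.orthonormal_right, submatrix_one _ he]
  -- Among the span of the top n + 1 right singular vectors, some direction is killed by `K`. There
  -- `X` and `X - F * K` agree, while `X` still stretches by at least `s k`.
  obtain ⟨x, hx, hx0⟩ := exists_mulVec_eq_zero_of_card_lt (K * P) (by simp)
  have hXP : (X * P)ᵀ * (X * P) = diagonal fun i => s (e i) ^ 2 := by
    have h1 : X * P = (U * diagonal s).submatrix id e := by
      rw [← h.mul_right]; rfl
    have h2 : (U * diagonal s)ᵀ * (U * diagonal s) = diagonal fun i => s i ^ 2 := by
      rw [transpose_mul, Matrix.mul_assoc, ← Matrix.mul_assoc Uᵀ, h.orthonormal_left,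
        Matrix.one_mul, diagonal_transpose, diagonal_mul_diagonal]
      simp only [sq]
    have h3 : (X * P)ᵀ * (X * P) = ((U * diagonal s)ᵀ * (U * diagonal s)).submatrix e e := by
      rw [h1]; rfl
    rw [h3, h2, submatrix_diagonal _ _ he]
    rfl
  have hlow := mul_dotProduct_le_of_diagonal hXP (c := s k ^ 2) (fun i =>
    pow_le_pow_left₀ (h.nonneg k) (h.antitone (Fin.le_def.2 (by
      simp only [e, Fin.val_castLE]; omega))) 2) x
  have hup := dotProduct_mulVec_self_le (X - F * K) (P *ᵥ x)
  have heq : (X - F * K) *ᵥ (P *ᵥ x) = (X * P) *ᵥ x := by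
    rw [sub_mulVec, mulVec_mulVec, mulVec_mulVec, Matrix.mul_assoc, ← mulVec_mulVec x F, hx0,
      mulVec_zero, sub_zero]
  rw [heq, mulVec_dotProduct_mulVec_of_orthonormal hP] at hup
  have h1 := le_of_mul_le_mul_right (hlow.trans hup) (dotProduct_self_pos hx)
  exact (le_of_sq_le_sq h1 (specNorm_nonneg _)).trans hδ

/-- Eckart–Young optimality: the residual keeps only singular values of index n and beyond, each
bounded by `IsSVD.le_of_factor`. Rank at most n is expressed by a factorisation. -/
theorem IsRankApprox.specNorm_sub_le [DecidableEq κ] {n : ℕ} {X L : Matrix ι κ ℝ}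
    (h : IsRankApprox n X L) {Y : Matrix ι κ ℝ} {F : Matrix ι (Fin n) ℝ}
    {K : Matrix (Fin n) κ ℝ} (hY : Y = F * K) : specNorm (X - L) ≤ specNorm (X - Y) := by
  subst hY
  obtain ⟨r, U, s, V, hS, rfl⟩ := h
  have h1 : X - U * diagonal (fun k : Fin r => if (k : ℕ) < n then s k else 0) * Vᵀ
      = U * (diagonal (fun k : Fin r => if (k : ℕ) < n then 0 else s k) * Vᵀ) := by
    rw [hS.eq, Matrix.mul_assoc, Matrix.mul_assoc, ← Matrix.mul_sub, ← Matrix.sub_mul,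
      diagonal_sub]
    congr 3
    ext k
    split_ifs <;> simp
  have h0 := specNorm_nonneg (X - F * K)
  rw [h1]
  refine (specNorm_mul_le _ _).trans ?_
  refine (mul_le_of_le_one_left (specNorm_nonneg _)
    (specNorm_le_one_of_orthonormal hS.orthonormal_left)).trans ?_
  refine (specNorm_mul_le _ _).trans ?_
  have h2 : specNorm Vᵀ ≤ 1 := by
    rw [specNorm_transpose]
    exact specNorm_le_one_of_orthonormal hS.orthonormal_right
  refine (mul_le_of_le_one_right (specNorm_nonneg _) h2).trans ?_
  refine specNorm_diagonal_le h0 fun k => ?_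
  split_ifs with hk
  · simpa using h0
  · rw [abs_of_nonneg (hS.nonneg k)]
    exact hS.le_of_factor le_rfl (not_lt.1 hk)

theorem specNorm_zero [DecidableEq κ] : specNorm (0 : Matrix ι κ ℝ) = 0 := by
  unfold specNorm
  open scoped Matrix.Norms.L2Operator in exact norm_zero

theorem eq_of_specNorm_sub_le_zero [DecidableEq κ] {X Y : Matrix ι κ ℝ}
    (h : specNorm (X - Y) ≤ 0) : X = Y := by
  unfold specNorm at h
  open scoped Matrix.Norms.L2Operator in exact sub_eq_zero.1 (norm_le_zero_iff.1 h)

theorem IsRankApprox.eq_of_factor [DecidableEq κ] {n : ℕ} {X L : Matrix ι κ ℝ}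
    (h : IsRankApprox n X L) {F : Matrix ι (Fin n) ℝ} {K : Matrix (Fin n) κ ℝ} (hX : X = F * K) :
    X = L := by
  refine eq_of_specNorm_sub_le_zero ((h.specNorm_sub_le hX).trans ?_)
  rw [sub_self, specNorm_zero]

theorem specNorm_one_sub_le_one [DecidableEq κ] {P : Matrix κ κ ℝ} (h : P * P = P) (hs : Pᵀ = P) :
    specNorm (1 - P) ≤ 1 := by
  refine specNorm_le_one_of_projection ?_
  rw [transpose_sub, transpose_one, hs]
  simp [Matrix.sub_mul, Matrix.mul_sub, h]

theorem mul_transpose_idempotent [DecidableEq κ] {U : Matrix ι κ ℝ} (h : Uᵀ * U = 1) :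
    U * Uᵀ * (U * Uᵀ) = U * Uᵀ := by
  rw [Matrix.mul_assoc, ← Matrix.mul_assoc Uᵀ, h, Matrix.one_mul]

/-- The difference splits as UUᵀE + (1 - UUᵀ)EV'V'ᵀ, because 1 - UUᵀ kills `L` and V'V'ᵀ fixes `L'`
on the right. Each piece passes through dimension n and costs one √n. -/
theorem frobNorm_sub_le_of_isSVD [DecidableEq ι] [DecidableEq κ] {n : ℕ} {L L' : Matrix ι κ ℝ}
    {U U' : Matrix ι (Fin n) ℝ} {s s' : Fin n → ℝ} {V V' : Matrix κ (Fin n) ℝ}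
    (h : IsSVD L U s V) (h' : IsSVD L' U' s' V') :
    frobNorm (L - L') ≤ 2 * √n * specNorm (L - L') := by
  set E := L - L' with hE
  have hL : U * (Uᵀ * L) = L := by
    rw [h.eq, ← Matrix.mul_assoc, ← Matrix.mul_assoc, ← Matrix.mul_assoc, Matrix.mul_assoc U,
      h.orthonormal_left, Matrix.mul_one]
  have hL' : L' * V' * V'ᵀ = L' := by rw [h'.mul_right, ← h'.eq]
  have hsplit : E = U * (Uᵀ * E) + (1 - U * Uᵀ) * (E * V') * V'ᵀ := by
    have h1 : (1 - U * Uᵀ) * E = -((1 - U * Uᵀ) * L') := by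
      have : (1 - U * Uᵀ) * L = 0 := by
        rw [Matrix.sub_mul, Matrix.one_mul, Matrix.mul_assoc, hL, sub_self]
      rw [hE, Matrix.mul_sub, this, zero_sub]
    have h2 : (1 - U * Uᵀ) * (E * V') * V'ᵀ = (1 - U * Uᵀ) * E := by
      rw [← Matrix.mul_assoc, h1, Matrix.neg_mul, Matrix.neg_mul, Matrix.mul_assoc,
        Matrix.mul_assoc, ← Matrix.mul_assoc L', hL']
    rw [h2, Matrix.sub_mul, Matrix.one_mul, Matrix.mul_assoc]
    abel
  have hU := specNorm_le_one_of_orthonormal h.orthonormal_left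
  have hV := specNorm_le_one_of_orthonormal h'.orthonormal_right
  have hP := specNorm_one_sub_le_one (mul_transpose_idempotent h.orthonormal_left)
    (by rw [transpose_mul, transpose_transpose])
  have hn : √(Fintype.card (Fin n)) = √n := by simp
  have b1 : frobNorm (U * (Uᵀ * E)) ≤ √n * specNorm E := by
    refine (frobNorm_mul_le_left _ _).trans ?_
    refine (mul_le_of_le_one_left (frobNorm_nonneg _) hU).trans ?_
    rw [← frobNorm_transpose]
    refine (frobNorm_le_sqrt_card_mul _).trans ?_
    rw [hn, specNorm_transpose]
    refine mul_le_mul_of_nonneg_left ((specNorm_mul_le _ _).trans ?_) (Real.sqrt_nonneg _)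
    rw [specNorm_transpose]
    exact mul_le_of_le_one_left (specNorm_nonneg _) hU
  have b2 : frobNorm ((1 - U * Uᵀ) * (E * V') * V'ᵀ) ≤ √n * specNorm E := by
    refine (frobNorm_mul_le_right _ _).trans ?_
    rw [specNorm_transpose]
    refine (mul_le_of_le_one_right (frobNorm_nonneg _) hV).trans ?_
    refine (frobNorm_mul_le_left _ _).trans ?_
    refine (mul_le_of_le_one_left (frobNorm_nonneg _) hP).trans ?_
    refine (frobNorm_le_sqrt_card_mul _).trans ?_
    rw [hn]
    refine mul_le_mul_of_nonneg_left ((specNorm_mul_le _ _).trans ?_) (Real.sqrt_nonneg _)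
    exact mul_le_of_le_one_right (specNorm_nonneg _) hV
  have h3 : frobNorm E ≤ _ := (congrArg frobNorm hsplit).trans_le (frobNorm_add_le _ _)
  linarith

end SingularValues

/-! ### Alignment of balanced factorisations -/

section BalancedFactors

variable {ι κ : Type*} [Fintype ι] [Fintype κ] {n : ℕ}

theorem singularValue_le_specNorm [DecidableEq κ] (hn : 0 < n) {M : Matrix ι κ ℝ}
    (hσ : 0 < singularValue n M) : singularValue n M ≤ specNorm M := by
  obtain ⟨P, hP, h⟩ := exists_orthonormal_singularValue_le hσ
  set x : Fin n → ℝ := Pi.single ⟨0, hn⟩ 1 with hx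
  have hx1 : x ⬝ᵥ x = 1 := by simp [hx]
  have h1 := h x
  have h2 := dotProduct_mulVec_self_le M (P *ᵥ x)
  rw [mulVec_dotProduct_mulVec_of_orthonormal hP, mulVec_mulVec] at h2
  rw [hx1] at h1 h2
  exact le_of_sq_le_sq (by linarith) (specNorm_nonneg M)

/-- A perturbation of norm at most `c` lowers the lowest of the `n` singular values
by at most `c`. -/
theorem IsSVD.sub_le_of_specNorm_sub_le [DecidableEq κ] {L L' : Matrix ι κ ℝ}
    (hσ : 0 < singularValue n L) {U : Matrix ι (Fin n) ℝ} {s : Fin n → ℝ}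
    {V : Matrix κ (Fin n) ℝ} (h : IsSVD L' U s V) {c : ℝ} (hL : specNorm (L - L') ≤ c)
    (hc : c ≤ singularValue n L) (k : Fin n) : singularValue n L - c ≤ s k := by
  obtain ⟨P, hP, hlow⟩ := exists_orthonormal_singularValue_le hσ
  refine h.le_of_orthonormal hP (fun x => ?_) k
  have h1 := hlow x
  have h2 := dotProduct_mulVec_self_le (L - L') (P *ᵥ x)
  rw [mulVec_dotProduct_mulVec_of_orthonormal hP, sub_mulVec, mulVec_mulVec, mulVec_mulVec] at h2
  set y := (L * P) *ᵥ x
  set z := (L' * P) *ᵥ x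
  -- On the top-n right singular subspace of `L`, the triangle inequality shows that `L'` still
  -- expands by the singular value minus `c`.
  have h3 : ‖WithLp.toLp 2 y‖ ≤ ‖WithLp.toLp 2 z‖ + ‖WithLp.toLp 2 (y - z)‖ := by
    have := norm_add_le (WithLp.toLp 2 z) (WithLp.toLp 2 (y - z))
    rwa [← WithLp.toLp_add, add_sub_cancel] at this
  rw [← norm_toLp_sq, ← norm_toLp_sq, ← mul_pow] at h1 h2 ⊢
  have h4 := le_of_sq_le_sq h1 (norm_nonneg _)
  have h5 := le_of_sq_le_sq h2 (mul_nonneg (specNorm_nonneg _) (norm_nonneg _))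
  have h6 := mul_le_mul_of_nonneg_right hL (norm_nonneg (WithLp.toLp 2 x))
  refine pow_le_pow_left₀ (mul_nonneg (by linarith) (norm_nonneg _)) ?_ 2
  rw [sub_mul]
  linarith

theorem frobNorm_mul_transpose_sub_sq [DecidableEq ι] (Z Y : Matrix ι κ ℝ) :
    frobNorm (Z * Zᵀ - Y * Yᵀ) ^ 2
      = trace (Zᵀ * Z * (Zᵀ * Z)) + trace (Yᵀ * Y * (Yᵀ * Y)) - 2 * frobNorm (Yᵀ * Z) ^ 2 := by
  have a1 : ∀ A B : Matrix ι κ ℝ, trace (A * Aᵀ * (B * Bᵀ)) = trace (Bᵀ * A * (Aᵀ * B)) := by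
    intro A B
    rw [← Matrix.mul_assoc, trace_mul_comm, ← Matrix.mul_assoc, ← Matrix.mul_assoc,
      Matrix.mul_assoc (Bᵀ * A)]
  rw [frobNorm_sq_eq_trace, frobNorm_sq_eq_trace]
  simp only [transpose_sub, transpose_mul, transpose_transpose, Matrix.sub_mul, Matrix.mul_sub,
    trace_sub, a1]
  rw [trace_mul_comm (Yᵀ * Z)]
  ring

/-- The gap is ‖a - b‖_F². This handles the cross terms when the Gram difference of stacked factors
is compared with the difference of their products. -/
theorem four_mul_trace_le_frobNorm_add_sq (a b : Matrix ι κ ℝ) :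
    4 * trace (aᵀ * b) ≤ frobNorm (a + b) ^ 2 := by
  have h0 := sq_nonneg (frobNorm (a - b))
  have h1 : trace (bᵀ * a) = trace (aᵀ * b) := by
    rw [← trace_transpose, transpose_mul, transpose_transpose]
  rw [frobNorm_sq_eq_trace] at h0 ⊢
  simp only [transpose_sub, transpose_add, Matrix.sub_mul, Matrix.mul_sub, Matrix.add_mul,
    Matrix.mul_add, trace_sub, trace_add] at h0 ⊢
  linarith

theorem frobNorm_fromRows_sq {l : Type*} [Fintype l] (M : Matrix ι κ ℝ) (N : Matrix l κ ℝ) :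
    frobNorm (fromRows M N) ^ 2 = frobNorm M ^ 2 + frobNorm N ^ 2 := by
  simp [frobNorm_sq]

theorem diagonal_sqrt_mul_self {s : Fin n → ℝ} (hs : ∀ k, 0 ≤ s k) :
    (diagonal fun k => √(s k)) * (diagonal fun k => √(s k)) = diagonal s := by
  rw [diagonal_mul_diagonal]
  congr 1
  funext k
  exact Real.mul_self_sqrt (hs k)

theorem transpose_mul_self_of_orthonormal {U : Matrix ι (Fin n) ℝ} (hU : Uᵀ * U = 1)
    {s : Fin n → ℝ} (hs : ∀ k, 0 ≤ s k) :
    (U * diagonal fun k => √(s k))ᵀ * (U * diagonal fun k => √(s k)) = diagonal s := by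
  rw [transpose_mul, Matrix.mul_assoc, ← Matrix.mul_assoc Uᵀ, hU, Matrix.one_mul,
    diagonal_transpose, diagonal_sqrt_mul_self hs]

theorem IsSVD.eq_mul {L : Matrix ι κ ℝ} {U : Matrix ι (Fin n) ℝ} {s : Fin n → ℝ}
    {V : Matrix κ (Fin n) ℝ} (h : IsSVD L U s V) :
    L = (U * diagonal fun k => √(s k)) * (V * diagonal fun k => √(s k))ᵀ := by
  rw [transpose_mul, diagonal_transpose, Matrix.mul_assoc, ← Matrix.mul_assoc (diagonal _),
    diagonal_sqrt_mul_self h.nonneg, ← Matrix.mul_assoc, ← h.eq]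

theorem trace_transpose_mul_mul_transpose (O O' : Matrix ι (Fin n) ℝ) (P P' : Matrix κ (Fin n) ℝ) :
    trace ((O * Pᵀ)ᵀ * (O' * P'ᵀ)) = trace ((O'ᵀ * O)ᵀ * (P'ᵀ * P)) := by
  rw [transpose_mul, transpose_mul, transpose_transpose, transpose_transpose, Matrix.mul_assoc P,
    trace_mul_comm P]
  simp only [Matrix.mul_assoc]

/-- Balanced factors of two matrices agree up to an orthogonal matrix and an error controlled
by the Frobenius distance of the matrices. -/
theorem exists_orthogonal_balanced_factors [DecidableEq ι] [DecidableEq κ] {L L' : Matrix ι κ ℝ}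
    {U U' : Matrix ι (Fin n) ℝ} {s s' : Fin n → ℝ} {V V' : Matrix κ (Fin n) ℝ}
    (h : IsSVD L U s V) (h' : IsSVD L' U' s' V') {c : ℝ} (hc : ∀ k, c ≤ s k) :
    ∃ W : Matrix (Fin n) (Fin n) ℝ, Wᵀ * W = 1 ∧ W * Wᵀ = 1 ∧
      c * (frobNorm ((U * diagonal fun k => √(s k)) - (U' * diagonal fun k => √(s' k)) * W) ^ 2
        + frobNorm ((V * diagonal fun k => √(s k)) - (V' * diagonal fun k => √(s' k)) * W) ^ 2)
        ≤ 4 * frobNorm (L - L') ^ 2 := by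
  have hL := h.eq_mul
  have hL' := h'.eq_mul
  have hO := transpose_mul_self_of_orthonormal h.orthonormal_left h.nonneg
  have hP := transpose_mul_self_of_orthonormal h.orthonormal_right h.nonneg
  have hO' := transpose_mul_self_of_orthonormal h'.orthonormal_left h'.nonneg
  have hP' := transpose_mul_self_of_orthonormal h'.orthonormal_right h'.nonneg
  set O := U * diagonal fun k => √(s k)
  set P := V * diagonal fun k => √(s k)
  set O' := U' * diagonal fun k => √(s' k)
  set P' := V' * diagonal fun k => √(s' k)
  set Z := fromRows O P with hZ
  set Z' := fromRows O' P' with hZ'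
  have hZZ : Zᵀ * Z = (2 : ℝ) • diagonal s := by
    rw [hZ, transpose_fromRows, fromCols_mul_fromRows, hO, hP, two_smul]
  have hZZ' : Z'ᵀ * Z' = (2 : ℝ) • diagonal s' := by
    rw [hZ', transpose_fromRows, fromCols_mul_fromRows, hO', hP', two_smul]
  have hcross : Z'ᵀ * Z = O'ᵀ * O + P'ᵀ * P := by
    rw [hZ, hZ', transpose_fromRows, fromCols_mul_fromRows]
  obtain ⟨W, hW, hW', hpsd⟩ := exists_orthogonal_transpose_mul_eq (Z'ᵀ * Z)
  refine ⟨W, hW, hW', ?_⟩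
  -- Stacking doubles the Gram matrix to 2Σ, which cancels the factor 1/2 in the alignment bound.
  have hmain := mul_frobNorm_sub_sq_le (U := Z) (X := Z' * W) (c := 2 * c)
    (mul_dotProduct_le_of_diagonal (d := fun k => 2 * s k)
      (by rw [hZZ]; ext i j; simp [diagonal_apply]) fun k => by linarith [hc k])
    (by rwa [transpose_mul, Matrix.mul_assoc])
  have hsub : Z - Z' * W = fromRows (O - O' * W) (P - P' * W) := by
    rw [hZ, hZ', fromRows_mul]
    ext (i | i) j <;> simp
  have hWW : Z' * W * (Z' * W)ᵀ = Z' * Z'ᵀ := by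
    rw [transpose_mul, Matrix.mul_assoc, ← Matrix.mul_assoc W, hW', Matrix.one_mul]
  -- After expansion both sides share 4 tr Σ² + 4 tr Σ'², by balance. What remains is `e5`, doubled.
  have hup : frobNorm (Z * Zᵀ - Z' * Z'ᵀ) ^ 2 ≤ 4 * frobNorm (L - L') ^ 2 := by
    have e1 : trace (Lᵀ * L) = trace (diagonal s * diagonal s) := by
      rw [hL, trace_transpose_mul_mul_transpose, hO, hP, diagonal_transpose]
    have e2 : trace (L'ᵀ * L') = trace (diagonal s' * diagonal s') := by
      rw [hL', trace_transpose_mul_mul_transpose, hO', hP', diagonal_transpose]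
    have e3 : trace (Lᵀ * L') = trace ((O'ᵀ * O)ᵀ * (P'ᵀ * P)) := by
      rw [hL, hL', trace_transpose_mul_mul_transpose]
    have e4 : trace (L'ᵀ * L) = trace (Lᵀ * L') := by
      rw [← trace_transpose, transpose_mul, transpose_transpose]
    have e5 := four_mul_trace_le_frobNorm_add_sq (O'ᵀ * O) (P'ᵀ * P)
    rw [frobNorm_mul_transpose_sub_sq, hZZ, hZZ', hcross, frobNorm_sq_eq_trace (L - L')]
    simp only [transpose_sub, Matrix.sub_mul, Matrix.mul_sub, trace_sub, Matrix.smul_mul,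
      Matrix.mul_smul, trace_smul, smul_eq_mul, e4, e1, e2, e3]
    linarith
  rw [hWW, hsub, frobNorm_fromRows_sq] at hmain
  linarith

end BalancedFactors

/-! ### Perturbation of pseudo-inverses -/

section PseudoInverse

variable {ι κ : Type*} [Fintype ι] [Fintype κ] {n : ℕ}

theorem IsMoorePenrose.transpose {M : Matrix ι κ ℝ} {X : Matrix κ ι ℝ} (h : IsMoorePenrose M X) :
    IsMoorePenrose Mᵀ Xᵀ where
  mul_mul := by rw [← transpose_mul, ← transpose_mul, ← Matrix.mul_assoc, h.mul_mul]
  mul_mul' := by rw [← transpose_mul, ← transpose_mul, ← Matrix.mul_assoc, h.mul_mul']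
  symm_left := by rw [← transpose_mul, h.symm_right, h.symm_right]
  symm_right := by rw [← transpose_mul, h.symm_left, h.symm_left]

theorem pinv_transpose (M : Matrix ι κ ℝ) : pinv Mᵀ = (pinv M)ᵀ :=
  (pinv_spec _).unique (pinv_spec M).transpose

/-- `X` is a Moore–Penrose inverse and a left inverse of `M`, with norm at most `b`. -/
structure IsLeftPinv [DecidableEq ι] [DecidableEq κ] (M : Matrix ι κ ℝ) (X : Matrix κ ι ℝ)
    (b : ℝ) : Prop where
  left_inv : X * M = 1
  symm : (M * X)ᵀ = M * X
  specNorm_le : specNorm X ≤ b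

theorem isLeftPinv_pinv [DecidableEq ι] {U : Matrix ι (Fin n) ℝ} (hU : Uᵀ * U = 1)
    {s : Fin n → ℝ} {c : ℝ} (hc : 0 < c) (hs : ∀ k, c ≤ s k) :
    IsLeftPinv (U * diagonal fun k => √(s k)) (pinv (U * diagonal fun k => √(s k)))
      (√c)⁻¹ := by
  have hs0 : ∀ k, √(s k) ≠ 0 := fun k => (Real.sqrt_pos.2 (hc.trans_le (hs k))).ne'
  set O := U * diagonal fun k => √(s k) with hO
  set X := (diagonal fun k => (√(s k))⁻¹) * Uᵀ with hX
  have h1 : X * O = 1 := by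
    rw [hX, hO, Matrix.mul_assoc, ← Matrix.mul_assoc Uᵀ, hU, Matrix.one_mul,
      diagonal_mul_diagonal, ← diagonal_one]
    congr 1
    funext k
    exact inv_mul_cancel₀ (hs0 k)
  have h2 : O * X = U * Uᵀ := by
    rw [hX, hO, Matrix.mul_assoc, ← Matrix.mul_assoc (diagonal _), diagonal_mul_diagonal]
    simp only [mul_inv_cancel₀ (hs0 _), diagonal_one, Matrix.one_mul]
  have h3 : (O * X)ᵀ = O * X := by rw [h2, transpose_mul, transpose_transpose]
  have h4 : pinv O = X := (pinv_spec O).unique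
    ⟨by rw [Matrix.mul_assoc, h1, Matrix.mul_one], by rw [h1, Matrix.one_mul], h3,
      by rw [h1, transpose_one]⟩
  rw [h4]
  refine ⟨h1, h3, (specNorm_mul_le _ _).trans ?_⟩
  have h5 : specNorm Uᵀ ≤ 1 := by
    rw [specNorm_transpose]
    exact specNorm_le_one_of_orthonormal hU
  refine (mul_le_of_le_one_right (specNorm_nonneg _) h5).trans
    (specNorm_diagonal_le (inv_nonneg.2 (Real.sqrt_nonneg _)) fun k => ?_)
  rw [abs_of_nonneg (inv_nonneg.2 (Real.sqrt_nonneg _))]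
  exact inv_anti₀ (Real.sqrt_pos.2 hc) (Real.sqrt_le_sqrt (hs k))

/-- Moves the rotation `W` inside the pseudo-inverse, so that the aligned factors can be compared
directly. -/
theorem IsLeftPinv.mul_orthogonal [DecidableEq ι] [DecidableEq κ] {M : Matrix ι κ ℝ}
    {X : Matrix κ ι ℝ} {b : ℝ} (h : IsLeftPinv M X b) {W : Matrix κ κ ℝ} (hW : Wᵀ * W = 1)
    (hW' : W * Wᵀ = 1) : IsLeftPinv (M * W) (Wᵀ * X) b where
  left_inv := by
    rw [Matrix.mul_assoc, ← Matrix.mul_assoc X, h.left_inv, Matrix.one_mul, hW]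
  symm := by
    rw [Matrix.mul_assoc, ← Matrix.mul_assoc W, hW', Matrix.one_mul, h.symm]
  specNorm_le := by
    refine (specNorm_mul_le _ _).trans ((mul_le_of_le_one_left (specNorm_nonneg _) ?_).trans
      h.specNorm_le)
    rw [specNorm_transpose]
    exact specNorm_le_one_of_orthonormal hW

/-- Perturbation bound for Moore–Penrose inverses of matrices with full column rank. -/
theorem IsLeftPinv.frobNorm_sub_le [DecidableEq ι] [DecidableEq κ] {M N : Matrix ι κ ℝ}
    {X Y : Matrix κ ι ℝ} {b : ℝ} (hX : IsLeftPinv M X b) (hY : IsLeftPinv N Y b) :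
    frobNorm (X - Y) ≤ 2 * b ^ 2 * frobNorm (M - N) := by
  have hXX : M * X * (M * X) = M * X := by
    rw [← Matrix.mul_assoc, Matrix.mul_assoc M, hX.left_inv, Matrix.mul_one]
  have hMX : Mᵀ * (1 - M * X) = 0 := by
    rw [Matrix.mul_sub, Matrix.mul_one, ← hX.symm, ← transpose_mul, Matrix.mul_assoc,
      hX.left_inv, Matrix.mul_one, sub_self]
  have hYN : Y * Yᵀ * Nᵀ = Y := by
    rw [Matrix.mul_assoc, ← transpose_mul, hY.symm, ← Matrix.mul_assoc, hY.left_inv,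
      Matrix.one_mul]
  -- Wedin's decomposition. The usual third term is absent because both matrices have left inverses.
  have hsplit : X - Y = Y * Yᵀ * (M - N)ᵀ * (1 - M * X) + -(Y * (M - N) * X) := by
    have h1 : Y * Yᵀ * (M - N)ᵀ * (1 - M * X) = -(Y * (1 - M * X)) := by
      rw [transpose_sub, Matrix.mul_sub (Y * Yᵀ), Matrix.sub_mul, hYN, Matrix.mul_assoc (Y * Yᵀ), hMX,
        Matrix.mul_zero, zero_sub]
    rw [h1, Matrix.mul_sub, Matrix.mul_sub, Matrix.sub_mul, Matrix.mul_one, hY.left_inv,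
      Matrix.one_mul, Matrix.mul_assoc]
    abel
  have hb : 0 ≤ b := (specNorm_nonneg X).trans hX.specNorm_le
  have hE := frobNorm_nonneg (M - N)
  have b1 : frobNorm (Y * Yᵀ * (M - N)ᵀ * (1 - M * X)) ≤ b ^ 2 * frobNorm (M - N) := by
    refine (frobNorm_mul_le_right _ _).trans ?_
    refine (mul_le_of_le_one_right (frobNorm_nonneg _)
      (specNorm_one_sub_le_one hXX hX.symm)).trans ?_
    refine (frobNorm_mul_le_left _ _).trans ?_
    rw [frobNorm_transpose]
    refine mul_le_mul_of_nonneg_right ((specNorm_mul_le _ _).trans ?_) hE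
    rw [specNorm_transpose, ← sq]
    exact pow_le_pow_left₀ (specNorm_nonneg _) hY.specNorm_le 2
  have b2 : frobNorm (-(Y * (M - N) * X)) ≤ b ^ 2 * frobNorm (M - N) := by
    rw [frobNorm_neg]
    refine (frobNorm_mul_le_right _ _).trans ?_
    refine (mul_le_mul (frobNorm_mul_le_left _ _) hX.specNorm_le (specNorm_nonneg _)
      (mul_nonneg (specNorm_nonneg _) hE)).trans ?_
    have := mul_le_mul_of_nonneg_right (mul_le_mul_of_nonneg_right hY.specNorm_le hE) hb
    linarith
  have h3 := (congrArg frobNorm hsplit).trans_le (frobNorm_add_le _ _)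
  linarith

end PseudoInverse

/-! ### Hankel matrices and the estimate for A -/

section Runs

/-- Block (i, j), counted from zero, is CA^(i+j)B: the shift by one in `hankel` skips D. Splitting
the power gives observability times controllability. -/
theorem dropLast_hankel_markov {n m p T : ℕ} (T₁ T₂ : ℕ) (h : T₁ + (T₂ + 1) ≤ T)
    (A : Matrix (Fin n) (Fin n) ℝ) (B : Matrix (Fin n) (Fin p) ℝ)
    (C : Matrix (Fin m) (Fin n) ℝ) (D : Matrix (Fin m) (Fin p) ℝ) :
    dropLast (hankel T₁ (T₂ + 1) h (markov T A B C D))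
      = (of fun (i : Fin T₁ × Fin m) (k : Fin n) => (C * A ^ (i.1 : ℕ)) i.2 k)
        * (of fun (k : Fin n) (j : Fin T₂ × Fin p) => (A ^ (j.1 : ℕ) * B) k j.2) := by
  ext i j
  have h1 : dropLast (hankel T₁ (T₂ + 1) h (markov T A B C D)) i j
      = (C * A ^ ((i.1 : ℕ) + (j.1 : ℕ)) * B) i.2 j.2 := rfl
  rw [h1, pow_add, ← Matrix.mul_assoc, Matrix.mul_assoc (C * A ^ (i.1 : ℕ))]
  rfl

variable {ι : Type*} [Fintype ι] {p S : ℕ}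

theorem specNorm_dropLast_le (H : Matrix ι (Fin (S + 1) × Fin p) ℝ) :
    specNorm (dropLast H) ≤ specNorm H :=
  specNorm_submatrix_le H fun a b hab => by
    simp only [Prod.mk.injEq, Fin.castSucc_inj] at hab
    exact Prod.ext hab.1 hab.2

theorem specNorm_dropFirst_le (H : Matrix ι (Fin (S + 1) × Fin p) ℝ) :
    specNorm (dropFirst H) ≤ specNorm H :=
  specNorm_submatrix_le H fun a b hab => by
    simp only [Prod.mk.injEq, Fin.succ_inj] at hab
    exact Prod.ext hab.1 hab.2

theorem IsSVD.singularValue_le {κ : Type*} [Fintype κ] [DecidableEq κ] {n : ℕ}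
    {L : Matrix ι κ ℝ} (hσ : 0 < singularValue n L) {U : Matrix ι (Fin n) ℝ} {s : Fin n → ℝ}
    {V : Matrix κ (Fin n) ℝ} (h : IsSVD L U s V) (k : Fin n) : singularValue n L ≤ s k := by
  obtain ⟨P, hP, hlow⟩ := exists_orthonormal_singularValue_le hσ
  exact h.le_of_orthonormal hP hlow k

/-- Perturbation of the product of a left pseudo-inverse, a matrix and a right pseudo-inverse. -/
theorem frobNorm_mul_mul_sub_le {κ : Type*} [Fintype κ] [DecidableEq ι] [DecidableEq κ] {n : ℕ}
    {O O' : Matrix ι (Fin n) ℝ} {X X' : Matrix (Fin n) ι ℝ} {P P' : Matrix κ (Fin n) ℝ}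
    {Y Y' : Matrix (Fin n) κ ℝ} {b : ℝ} (hX : IsLeftPinv O X b) (hX' : IsLeftPinv O' X' b)
    (hY : IsLeftPinv P Y b) (hY' : IsLeftPinv P' Y' b) (K K' : Matrix ι κ ℝ) :
    frobNorm (X * K * Yᵀ - X' * K' * Y'ᵀ)
      ≤ 2 * b ^ 3 * specNorm K * (frobNorm (O - O') + frobNorm (P - P'))
        + √n * b ^ 2 * specNorm (K - K') := by
  have hb : 0 ≤ b := (specNorm_nonneg X).trans hX.specNorm_le
  have hK := specNorm_nonneg K
  have hKK := specNorm_nonneg (K - K')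
  have hYb : specNorm Yᵀ ≤ b := by rw [specNorm_transpose]; exact hY.specNorm_le
  have hYb' : specNorm Y'ᵀ ≤ b := by rw [specNorm_transpose]; exact hY'.specNorm_le
  have hsplit : X * K * Yᵀ - X' * K' * Y'ᵀ
      = ((X - X') * (K * Yᵀ) + X' * K * (Y - Y')ᵀ) + X' * (K - K') * Y'ᵀ := by
    simp only [transpose_sub, Matrix.sub_mul, Matrix.mul_sub, Matrix.mul_assoc]
    abel
  have b1 : frobNorm ((X - X') * (K * Yᵀ)) ≤ 2 * b ^ 2 * frobNorm (O - O') * (specNorm K * b) :=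
    (frobNorm_mul_le_right _ _).trans (mul_le_mul (hX.frobNorm_sub_le hX')
      ((specNorm_mul_le _ _).trans (mul_le_mul_of_nonneg_left hYb hK)) (specNorm_nonneg _)
      (mul_nonneg (by positivity) (frobNorm_nonneg _)))
  have b2 : frobNorm (X' * K * (Y - Y')ᵀ) ≤ b * specNorm K * (2 * b ^ 2 * frobNorm (P - P')) := by
    refine (frobNorm_mul_le_left _ _).trans (mul_le_mul ((specNorm_mul_le _ _).trans
      (mul_le_mul_of_nonneg_right hX'.specNorm_le hK)) ?_ (frobNorm_nonneg _) (mul_nonneg hb hK))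
    rw [frobNorm_transpose]
    exact hY.frobNorm_sub_le hY'
  have b3 : frobNorm (X' * (K - K') * Y'ᵀ) ≤ √n * (b * specNorm (K - K') * b) := by
    refine (frobNorm_le_sqrt_card_mul _).trans ?_
    rw [Fintype.card_fin]
    exact mul_le_mul_of_nonneg_left ((specNorm_mul_le _ _).trans (mul_le_mul
      ((specNorm_mul_le _ _).trans (mul_le_mul_of_nonneg_right hX'.specNorm_le hKK)) hYb'
      (specNorm_nonneg _) (mul_nonneg hb hKK))) (Real.sqrt_nonneg _)
  have h3 := (congrArg frobNorm hsplit).trans_le (frobNorm_add_le _ _)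
  have h4 := frobNorm_add_le ((X - X') * (K * Yᵀ)) (X' * K * (Y - Y')ᵀ)
  linarith

theorem two_mul_inv_sqrt_pow_mul_add_le {n δ σ h e f : ℝ} (hn : 0 ≤ n) (hδ : 0 ≤ δ) (hσ : 0 < σ)
    (hδσ : δ ≤ σ / 4) (hσh : σ ≤ h) (he : e ≤ 4 * √(n * δ)) (hf : f ≤ 4 * √(n * δ)) :
    2 * (√(σ / 2))⁻¹ ^ 3 * h * (e + f) + √n * (√(σ / 2))⁻¹ ^ 2 * δ
      ≤ 50 * √(n * δ) * h / σ ^ (3 / 2 : ℝ) := by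
  have hr : σ ^ (3 / 2 : ℝ) = σ * √σ := by
    rw [Real.sqrt_eq_rpow, ← Real.rpow_one_add' hσ.le (by norm_num)]
    norm_num
  have hs : 0 < √σ := Real.sqrt_pos.2 hσ
  have hss : √σ * √σ = σ := Real.mul_self_sqrt hσ.le
  have hh : 0 < h := hσ.trans_le hσh
  have hb2 : (√(σ / 2))⁻¹ ^ 2 = 2 / σ := by
    rw [inv_pow, Real.sq_sqrt (by positivity), inv_div]
  -- This is √2 ≤ 3/2.
  have hb1 : (√(σ / 2))⁻¹ ≤ 3 / 2 / √σ := by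
    rw [inv_le_comm₀ (Real.sqrt_pos.2 (by positivity)) (by positivity), inv_div]
    refine Real.le_sqrt_of_sq_le ?_
    rw [div_pow, sq (√σ), hss, div_le_iff₀ (by norm_num)]
    linarith
  have hb3 : (√(σ / 2))⁻¹ ^ 3 ≤ 3 / (σ * √σ) := by
    rw [pow_succ, hb2]
    refine (mul_le_mul_of_nonneg_left hb1 (by positivity)).trans_eq ?_
    field_simp
  have hd : √δ ≤ √σ / 2 := by
    refine Real.sqrt_le_iff.2 ⟨by positivity, ?_⟩
    rw [div_pow, sq (√σ), hss]
    linarith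
  have t1 : 2 * (√(σ / 2))⁻¹ ^ 3 * h * (e + f) ≤ 2 * (3 / (σ * √σ)) * h * (8 * √(n * δ)) := by
    refine (mul_le_mul_of_nonneg_left (show e + f ≤ 8 * √(n * δ) by linarith)
      (by positivity)).trans ?_
    gcongr
  have t2 : √n * (√(σ / 2))⁻¹ ^ 2 * δ ≤ √(n * δ) * h / (σ * √σ) := by
    rw [hb2, Real.sqrt_mul hn, le_div_iff₀ (by positivity)]
    have h1 : √n * (2 / σ) * δ * (σ * √σ) = √n * √δ * (2 * (√δ * √σ)) := by
      have : √n * (2 / σ) * δ * (σ * √σ) = √n * 2 * δ * √σ := by field_simp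
      rw [this]
      nth_rewrite 1 [← Real.mul_self_sqrt hδ]
      ring
    rw [h1]
    refine mul_le_mul_of_nonneg_left ?_ (by positivity)
    nlinarith
  rw [hr]
  refine (add_le_add t1 t2).trans ?_
  -- The pseudo-inverse errors contribute 48 and the change in H⁺ contributes 1.
  have h2 : 2 * (3 / (σ * √σ)) * h * (8 * √(n * δ)) + √(n * δ) * h / (σ * √σ)
      = 49 * √(n * δ) * h / (σ * √σ) := by ring
  rw [h2]
  gcongr
  norm_num

end Runs

end HoKalman

/-! ### Robustness of the Ho–Kalman algorithm -/

open HoKalman Matrix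

theorem mainTheorem5 (n m p T T₁ T₂ : ℕ) (hn : 0 < n) (h₁ : 0 < T₁) (h₂ : 0 < T₂)
    (hT : T₁ + T₂ + 1 = T)
    (A : Matrix (Fin n) (Fin n) ℝ) (B : Matrix (Fin n) (Fin p) ℝ)
    (C : Matrix (Fin m) (Fin n) ℝ) (D : Matrix (Fin m) (Fin p) ℝ)
    (hobs : HoKalman.IsObservable A C) (hctr : HoKalman.IsControllable A B)
    (Ghat : Matrix (Fin m) (Fin T × Fin p) ℝ)
    (R : HoKalman.Run n T₁ T₂ hT (HoKalman.markov T A B C D))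
    (Rhat : HoKalman.Run n T₁ T₂ hT Ghat)
    (hσ : 0 < HoKalman.singularValue n R.L)
    (hpert : HoKalman.specNorm (R.H - Rhat.H) ≤ HoKalman.singularValue n R.L / 4) :
    ∃ W ∈ Matrix.orthogonalGroup (Fin n) ℝ,
      max (max (HoKalman.frobNorm (R.outC h₁ - Rhat.outC h₁ * W))
            (HoKalman.frobNorm (R.O - Rhat.O * W)))
          (max (HoKalman.frobNorm (R.outB h₂ - Wᵀ * Rhat.outB h₂))
            (HoKalman.frobNorm (R.Q - Wᵀ * Rhat.Q)))
        ≤ 5 * Real.sqrt (n * HoKalman.specNorm (R.H - Rhat.H)) ∧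
      HoKalman.frobNorm (R.outA - Wᵀ * Rhat.outA * W)
        ≤ 50 * Real.sqrt (n * HoKalman.specNorm (R.H - Rhat.H)) * HoKalman.specNorm R.H
          / HoKalman.singularValue n R.L ^ (3 / 2 : ℝ) := by
  set σ := singularValue n R.L
  set δ := specNorm (R.H - Rhat.H)
  have hδ : 0 ≤ δ := specNorm_nonneg _
  have hfac := dropLast_hankel_markov T₁ T₂ hT.le A B C D
  have hRL : dropLast R.H = R.L := R.isRankApprox.eq_of_factor hfac
  have hlast : specNorm (dropLast Rhat.H - dropLast R.H) ≤ δ := by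
    have h := specNorm_dropLast_le (R.H - Rhat.H)
    rw [specNorm_sub_comm]
    exact h
  have hhat : specNorm (dropLast Rhat.H - Rhat.L) ≤ δ :=
    (Rhat.isRankApprox.specNorm_sub_le hfac).trans hlast
  have hLL : specNorm (R.L - Rhat.L) ≤ 2 * δ := by
    have h1 : R.L - Rhat.L
        = (dropLast R.H - dropLast Rhat.H) + (dropLast Rhat.H - Rhat.L) := by
      rw [hRL]; abel
    rw [h1]
    refine (specNorm_add_le _ _).trans ?_
    rw [specNorm_sub_comm (dropLast R.H)]
    linarith
  have hs : ∀ k, σ ≤ R.s k := R.isSVD.singularValue_le hσ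
  have hs' : ∀ k, σ / 2 ≤ Rhat.s k := fun k => by
    -- The choice of `c` comes from 2δ ≤ σ/2.
    have := Rhat.isSVD.sub_le_of_specNorm_sub_le hσ (c := σ / 2) (by linarith) (by linarith) k
    linarith
  have hσH : σ ≤ specNorm R.H := by
    refine (singularValue_le_specNorm hn hσ).trans ?_
    rw [← hRL]
    exact specNorm_dropLast_le _
  have hF : frobNorm (R.L - Rhat.L) ^ 2 ≤ 16 * (n * δ ^ 2) := by
    have h1 := (frobNorm_sub_le_of_isSVD R.isSVD Rhat.isSVD).trans
      (mul_le_mul_of_nonneg_left hLL (by positivity))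
    refine (pow_le_pow_left₀ (frobNorm_nonneg _) h1 2).trans_eq ?_
    rw [mul_pow, mul_pow, Real.sq_sqrt (Nat.cast_nonneg n)]
    ring
  obtain ⟨W, hW, hW', hdist⟩ := exists_orthogonal_balanced_factors R.isSVD Rhat.isSVD hs
  have hQ : (R.V * diagonal fun k => √(R.s k)) = R.Qᵀ := by
    rw [Run.Q, transpose_mul, diagonal_transpose, transpose_transpose]
  have hQ' : (Rhat.V * diagonal fun k => √(Rhat.s k)) = Rhat.Qᵀ := by
    rw [Run.Q, transpose_mul, diagonal_transpose, transpose_transpose]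
  rw [hQ, hQ'] at hdist
  change σ * (frobNorm (R.O - Rhat.O * W) ^ 2 + frobNorm (R.Qᵀ - Rhat.Qᵀ * W) ^ 2) ≤ _ at hdist
  have hbound : frobNorm (R.O - Rhat.O * W) ^ 2 + frobNorm (R.Qᵀ - Rhat.Qᵀ * W) ^ 2
      ≤ 16 * (n * δ) := by
    refine le_of_mul_le_mul_left ?_ hσ
    -- One factor δ is traded for σ/4, turning 64nδ² into 16nδσ; this is why the final bound has a
    -- square root.
    have h1 : (n : ℝ) * δ * δ ≤ n * δ * (σ / 4) :=
      mul_le_mul_of_nonneg_left hpert (by positivity)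
    nlinarith
  have hroot : ∀ e : ℝ, e ^ 2 ≤ 16 * (n * δ) → e ≤ 4 * √(n * δ) := fun e he => by
    refine le_of_sq_le_sq ?_ (by positivity)
    rw [mul_pow, Real.sq_sqrt (by positivity)]
    linarith
  have hO4 : frobNorm (R.O - Rhat.O * W) ≤ 4 * √(n * δ) :=
    hroot _ (by nlinarith [sq_nonneg (frobNorm (R.Qᵀ - Rhat.Qᵀ * W))])
  have hQ4 : frobNorm (R.Qᵀ - Rhat.Qᵀ * W) ≤ 4 * √(n * δ) :=
    hroot _ (by nlinarith [sq_nonneg (frobNorm (R.O - Rhat.O * W))])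
  have hQ5 : frobNorm (R.Q - Wᵀ * Rhat.Q) ≤ 4 * √(n * δ) := by
    rw [← frobNorm_transpose, transpose_sub, transpose_mul, transpose_transpose]
    exact hQ4
  have h45 : 4 * √(n * δ) ≤ 5 * √(n * δ) := by nlinarith [Real.sqrt_nonneg (n * δ)]
  refine ⟨W, (mem_orthogonalGroup_iff _ _).2 hW', max_le (max_le ?_ (hO4.trans h45))
    (max_le ?_ (hQ5.trans h45)), ?_⟩
  · have h1 : R.outC h₁ - Rhat.outC h₁ * W
        = (R.O - Rhat.O * W).submatrix (fun i => ((⟨0, h₁⟩ : Fin T₁), i)) id := rfl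
    rw [h1]
    exact (frobNorm_submatrix_le _ (Prod.mk_right_injective _) Function.injective_id).trans
      (hO4.trans h45)
  · have h1 : R.outB h₂ - Wᵀ * Rhat.outB h₂
        = (R.Q - Wᵀ * Rhat.Q).submatrix id (fun j => ((⟨0, h₂⟩ : Fin T₂), j)) := rfl
    rw [h1]
    exact (frobNorm_submatrix_le _ Function.injective_id (Prod.mk_right_injective _)).trans
      (hQ5.trans h45)
  · have hσ2 : 0 < σ / 2 := by linarith
    -- The weaker bound σ/2 is used for the exact factors too, so that all four pseudo-inverses
    -- share one constant.
    have pX := isLeftPinv_pinv R.isSVD.orthonormal_left hσ2 fun k =>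
      (by linarith : σ / 2 ≤ σ).trans (hs k)
    have pY := isLeftPinv_pinv R.isSVD.orthonormal_right hσ2 fun k =>
      (by linarith : σ / 2 ≤ σ).trans (hs k)
    have pX' := (isLeftPinv_pinv Rhat.isSVD.orthonormal_left hσ2 hs').mul_orthogonal hW hW'
    have pY' := (isLeftPinv_pinv Rhat.isSVD.orthonormal_right hσ2 hs').mul_orthogonal hW hW'
    have hA := frobNorm_mul_mul_sub_le pX pX' pY pY' (dropFirst R.H) (dropFirst Rhat.H)
    rw [hQ, hQ', pinv_transpose, pinv_transpose, transpose_mul, transpose_transpose,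
      transpose_transpose, transpose_transpose] at hA
    have hAA : R.outA - Wᵀ * Rhat.outA * W = pinv R.O * dropFirst R.H * pinv R.Q
        - Wᵀ * pinv Rhat.O * dropFirst Rhat.H * (pinv Rhat.Q * W) := by
      simp only [Run.outA, Matrix.mul_assoc]
    rw [hAA]
    refine (LE.le.trans hA ?_).trans (two_mul_inv_sqrt_pow_mul_add_le
      (Nat.cast_nonneg n) hδ hσ hpert hσH hO4 hQ4)
    have k1 : specNorm (dropFirst R.H) ≤ specNorm R.H := specNorm_dropFirst_le _
    have k2 : specNorm (dropFirst R.H - dropFirst Rhat.H) ≤ δ :=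
      specNorm_dropFirst_le (R.H - Rhat.H)
    have k3 := frobNorm_nonneg (R.O - Rhat.O * W)
    have k4 := frobNorm_nonneg (R.Qᵀ - Rhat.Qᵀ * W)
    exact add_le_add (mul_le_mul_of_nonneg_right (mul_le_mul_of_nonneg_left k1 (by positivity))
      (add_nonneg k3 k4)) (mul_le_mul_of_nonneg_left k2 (by positivity))
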